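/- Theorem (incomparable thermal region and past thermal cone). Let $d\ge 1$, $E_1,\dots,E_d\in\mathbb R$, $\beta>0$, and let $\gamma_i=e^{-\beta E_i}/\sum_j e^{-\beta E_j}$ be the Gibbs distribution. Let $\Delta_d=\{p\in\mathbb R^d: p_i\ge 0,\ \sum_i p_i=1\}$ and $H_d=\{v\in\mathbb R^d:\sum_i v_i=1\}$. A Gibbs-preserving matrix is a real $d\times d$ matrix $\Lambda$ with non-negative entries, columns summing to $1$, and $\Lambda\gamma=\gamma$. For $v\in H_d$ let $\mathcal T^\beta_+(v)=\{\Lambda v:\Lambda \text{ Gibbs-preserving}\}\subseteq H_d$ (future thermal cone). For $p\in\Delta_d$ let $\mathcal T^\beta_-(p)$ (past thermal cone) be the set of $q\in\Delta_d$ such that $\Lambda q=p$ for some Gibbs-preserving $\Lambda$, and let $\mathcal T^\beta_\emptyset(p)=\Delta_d\setminus(\mathcal T^\beta_-(p)\cup\mathcal T^\beta_+(p))$ (incomparable thermal region). Let $p\in\Delta_d$, and let $(p^\beta_i)$, $(\gamma^\beta_i)$ be the entries of $p$ and $\gamma$ both listed in an order for which $p^\beta_1/\gamma^\beta_1\ge\dots\ge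 p^\beta_d/\gamma^\beta_d$ (any such order if there are ties). For $1\le n\le d$ and $\pi\in S_d$ let $t^{(n,\pi)}\in H_d$ be the vector (when $d\ge2$) with $$t^{(n,\pi)}_{\pi(1)}=\sum_{i=1}^n p^\beta_i-\frac{p^\beta_n}{\gamma^\beta_n}\Big(\sum_{i=1}^n\gamma^\beta_i-\gamma_{\pi(1)}\Big),\qquad t^{(n,\pi)}_{\pi(i)}=\frac{p^\beta_n}{\gamma^\beta_n}\gamma_{\pi(i)}\ \ (1<i<d),$$ $$t^{(n,\pi)}_{\pi(d)}=1-t^{(n,\pi)}_{\pi(1)}-\frac{p^\beta_n}{\gamma^\beta_n}\sum_{i=2}^{d-1}\gamma_{\pi(i)},$$ and put $$\mathbb T^\beta=\bigcup_{\pi\in S_d}\ \bigcup_{n=1}^{d-1}\operatorname{conv}\Big[\mathcal T^\beta_+\big(t^{(n,\pi)}\big)\cup\mathcal T^\beta_+\big(t^{(n+1,\pi)}\big)\Big]\subseteq H_d$$ (empty if $d=1$). Let $\operatorname{int}$ denote the interior relative to $H_d$. Then $$\mathcal T^\beta_\emptyset(p)=\big[\operatorname{int}(\mathbb T^\beta)\setminus\mathcal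 T^\beta_+(p)\big]\cap\Delta_d\qquad\text{and}\qquad \mathcal T^\beta_-(p)=\Delta_d\setminus\operatorname{int}(\mathbb T^\beta).$$ -/

import Mathlib

open scoped Matrix

noncomputable section

/-- The affine hyperplane of normalised vectors (quasi-probability distributions): real vectors
with entries summing to `1`, of arbitrary sign. -/
def quasiProb (d : ℕ) : Set (Fin d → ℝ) := {v | ∑ i, v i = 1}

/-- The interior of `S` relative to the hyperplane of normalised vectors. -/
def hyperplaneInterior {d : ℕ} (S : Set (Fin d → ℝ)) : Set (Fin d → ℝ) :=
  ((↑) : quasiProb d → (Fin d → ℝ)) '' interior (((↑) : quasiProb d → (Fin d → ℝ)) ⁻¹' S)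

/-- The thermal (Gibbs) distribution `γ_i = exp (-β E_i) / ∑_j exp (-β E_j)`. -/
def gibbs {d : ℕ} (β : ℝ) (E : Fin d → ℝ) (i : Fin d) : ℝ :=
  Real.exp (-β * E i) / ∑ j, Real.exp (-β * E j)

/-- Gibbs-preserving matrices: nonnegative entries, columns summing to `1`, fixing `γ`. -/
def IsGibbsPreserving {d : ℕ} (γ : Fin d → ℝ) (Λ : Matrix (Fin d) (Fin d) ℝ) : Prop :=
  Λ ∈ Matrix.colStochastic ℝ (Fin d) ∧ Λ *ᵥ γ = γ

/-- The future thermal cone of a vector, which may be a quasi-probability distribution: all images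
under Gibbs-preserving matrices. For `p` in the simplex it is contained in the simplex. -/
def futureCone {d : ℕ} (γ p : Fin d → ℝ) : Set (Fin d → ℝ) :=
  {q | ∃ Λ, IsGibbsPreserving γ Λ ∧ Λ *ᵥ p = q}

/-- The past thermal cone: the probability vectors that some Gibbs-preserving matrix maps to `p`. -/
def pastCone {d : ℕ} (γ p : Fin d → ℝ) : Set (Fin d → ℝ) :=
  {q | q ∈ stdSimplex ℝ (Fin d) ∧ ∃ Λ, IsGibbsPreserving γ Λ ∧ Λ *ᵥ q = p}

/-- The incomparable thermal region: the probability vectors neither in the past nor in the future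
thermal cone of `p`. -/
def incomparableRegion {d : ℕ} (γ p : Fin d → ℝ) : Set (Fin d → ℝ) :=
  {q | q ∈ stdSimplex ℝ (Fin d) ∧ q ∉ pastCone γ p ∧ q ∉ futureCone γ p}

/-- `σ` is a `β`-ordering of `p`: the ratios `p_i / γ_i`, listed in the order
`σ⁻¹(1), …, σ⁻¹(d)`, are non-increasing. -/
def IsBetaOrdering {d : ℕ} (γ p : Fin d → ℝ) (σ : Equiv.Perm (Fin d)) : Prop :=
  Antitone fun i => p (σ.symm i) / γ (σ.symm i)

/-- The vector `v` listed in the order given by `σ`: `(v_{σ⁻¹(1)}, …, v_{σ⁻¹(d)})`. -/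
def reorder {d : ℕ} (σ : Equiv.Perm (Fin d)) (v : Fin d → ℝ) (i : Fin d) : ℝ := v (σ.symm i)

/-- The slope `p^β_n / γ^β_n` of the `n`-th linear piece of the thermomajorisation curve. -/
def betaSlope {d : ℕ} (γ p : Fin d → ℝ) (σ : Equiv.Perm (Fin d)) (n : Fin d) : ℝ :=
  reorder σ p n / reorder σ γ n

/-- The first entry, in the order `π`, of the tangent vector `t^(n,π)`. -/
def tangentFirst {d : ℕ} [NeZero d] (γ p : Fin d → ℝ) (σ : Equiv.Perm (Fin d)) (n : Fin d)
    (π : Equiv.Perm (Fin d)) : ℝ :=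
  ∑ i ∈ Finset.Iic n, reorder σ p i
    - betaSlope γ p σ n * (∑ i ∈ Finset.Iic n, reorder σ γ i - γ (π 0))

/-- The last entry, in the order `π`, of the tangent vector `t^(n,π)`. -/
def tangentLast {d : ℕ} [NeZero d] (γ p : Fin d → ℝ) (σ : Equiv.Perm (Fin d)) (n : Fin d)
    (π : Equiv.Perm (Fin d)) : ℝ :=
  1 - tangentFirst γ p σ n π
    - betaSlope γ p σ n * ∑ i with i.val ≠ 0 ∧ i.val + 1 ≠ d, γ (π i)

/-- The tangent vector `t^(n,π)` in its `β`-ordered form: the `i`-th entry belongs to the energy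
level `π(i)`. -/
def tangentOrdered {d : ℕ} [NeZero d] (γ p : Fin d → ℝ) (σ : Equiv.Perm (Fin d)) (n : Fin d)
    (π : Equiv.Perm (Fin d)) (i : Fin d) : ℝ :=
  if i.val = 0 then tangentFirst γ p σ n π
  else if i.val + 1 = d then tangentLast γ p σ n π
  else betaSlope γ p σ n * γ (π i)

/-- The tangent vector `t^(n,π)`, indexed by energy levels. -/
def tangentVector {d : ℕ} [NeZero d] (γ p : Fin d → ℝ) (σ : Equiv.Perm (Fin d)) (n : Fin d)
    (π : Equiv.Perm (Fin d)) (j : Fin d) : ℝ :=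
  tangentOrdered γ p σ n π (π.symm j)

/-- The set `𝕋^β`: the union, over all permutations `π` and all pairs of consecutive indices, of
the convex hulls of the future thermal cones of two consecutive tangent vectors. -/
def tangentRegion {d : ℕ} [NeZero d] (γ p : Fin d → ℝ) (σ : Equiv.Perm (Fin d)) :
    Set (Fin d → ℝ) :=
  ⋃ (π : Equiv.Perm (Fin d)) (i : ℕ) (hi : i + 1 < d),
    convexHull ℝ (futureCone γ (tangentVector γ p σ ⟨i, Nat.lt_of_succ_lt hi⟩ π) ∪
      futureCone γ (tangentVector γ p σ ⟨i + 1, hi⟩ π))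

end

/-!
For a vector `v`, let `H_v(a) = ∑ᵢ (vᵢ - a γᵢ)⁺` (`hingeSum`), the Legendre dual of the
thermomajorisation curve of `v`. For vectors of equal sum, `q` is the image of `v` under a
Gibbs-preserving matrix if and only if `H_q ≤ H_v`. Necessity is Jensen's inequality
(`hingeSum_of_mem_futureCone`); sufficiency (`mem_futureCone_of_hingeSum_le`) follows by separating
`(γ, q)` from the compact convex set of pairs `(Λ γ, Λ v)`, `Λ` column-stochastic, since on finitely
many points a convex function is an affine function plus a nonnegative combination of hinges.

The first equation follows from the second by taking complements, and the second says that a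
probability vector `q` is in the interior of the tangent region exactly when `H_q(m) < H_p(m)` for
some `m` (`mem_hyperplaneInterior_tangentRegion_iff`).

* The condition `H_q(m) < H_p(m)` is open in `q`, so it suffices that it implies membership in the
  region. It forces `m` to lie between two consecutive slopes `p_n / γ_n` of the curve of `p`. On
  that interval `H_p` is affine, and for an ordering `π` of `q` the vector `q` is in the future cone
  of the corresponding convex combination of `t^(n,π)` and `t^(n+1,π)`
  (`mem_tangentRegion_of_hingeSum_lt`).
* Conversely, joint convexity of `H` shows that every `x` in the region satisfies `H_x(m) ≤ H_p(m)`
  at some slope `m` of the curve of `p`. If `H_p ≤ H_q`, all these slopes lie between the smallest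
  and the largest ratio `q_i / γ_i`, and transferring a weight `ε` from the level of smallest ratio
  to that of largest ratio adds `ε` to `H_q` at all of them. Thus vectors arbitrarily close to `q`
  lie outside the region.
-/

/-! ### Convex functions and hinges -/

/-- A chord of a convex function, extended to the right, stays below the function. -/
lemma ConvexOn.extrapolation_le {h : ℝ → ℝ} (hh : ConvexOn ℝ Set.univ h) {a b x : ℝ}
    (hab : a < b) (hbx : b ≤ x) : h b + (h b - h a) / (b - a) * (x - b) ≤ h x := by
  rcases hbx.eq_or_lt with rfl | hbx
  · simp
  have := hh.slope_mono_adjacent (Set.mem_univ a) (Set.mem_univ x) hab hbx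
  rw [le_div_iff₀ (by linarith)] at this
  linarith

/-- On a finite set, a convex function agrees with an affine function plus a nonnegative
combination of hinges `x ↦ max (x - a) 0`. The combination enters through a property `P` that
holds for affine functions and survives the addition of hinges. -/
lemma ConvexOn.exists_hinge_interpolant {h : ℝ → ℝ} (hh : ConvexOn ℝ Set.univ h)
    {P : (ℝ → ℝ) → Prop} (haff : ∀ k b : ℝ, P fun x => k * x + b)
    (hhinge : ∀ (g : ℝ → ℝ) (a c : ℝ), 0 ≤ c → P g → P fun x => g x + c * max (x - a) 0)
    (S : Finset ℝ) : ∃ g, P g ∧ ∀ x ∈ S, g x = h x := by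
  rcases S.eq_empty_or_nonempty with rfl | hS
  · exact ⟨_, haff 0 0, by simp⟩
  -- Invariant of the induction: beyond `m = max S` the interpolant is affine and below `h`.
  suffices H : ∃ g m k, P g ∧ m ∈ S ∧ (∀ x ∈ S, x ≤ m ∧ g x = h x) ∧
      ∀ x, m ≤ x → g x = h m + k * (x - m) ∧ g x ≤ h x by
    obtain ⟨g, m, k, hP, -, hg, -⟩ := H
    exact ⟨g, hP, fun x hx => (hg x hx).2⟩
  induction S using Finset.induction_on_max with
  | empty => simp at hS
  | insert M S hM ih =>
    rcases S.eq_empty_or_nonempty with rfl | hS'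
    · -- The chord over `[M - 1, M]` stays below `h` to the right of `M`.
      refine ⟨_, M, h M - h (M - 1), haff (h M - h (M - 1)) (h M - (h M - h (M - 1)) * M),
        by simp, by simp, fun x hx => ⟨by ring, ?_⟩⟩
      have := hh.extrapolation_le (a := M - 1) (b := M) (by linarith) hx
      simp only [sub_sub_cancel, div_one] at this
      linarith
    · obtain ⟨g, m, k, hP, hmS, hg, hr⟩ := ih hS'
      have hmM : m < M := hM m hmS
      have hMm : 0 < M - m := by linarith
      have hgM := hr M hmM.le
      refine ⟨_, M, (h M - h m) / (M - m), hhinge g m ((h M - g M) / (M - m))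
        (div_nonneg (by linarith [hgM.2]) hMm.le) hP, by simp, ?_, ?_⟩
      · intro x hx
        rcases Finset.mem_insert.1 hx with rfl | hx
        · refine ⟨le_rfl, ?_⟩
          rw [max_eq_left hMm.le, div_mul_cancel₀ _ hMm.ne']
          ring
        · have := hg x hx
          refine ⟨this.1.trans hmM.le, ?_⟩
          rw [max_eq_right (by linarith [this.1])]
          linarith [this.2]
      · intro x hx
        have hval : g x + (h M - g M) / (M - m) * max (x - m) 0 =
            h M + (h M - h m) / (M - m) * (x - M) := by
          rw [max_eq_left (by linarith), (hr x (by linarith)).1, hgM.1]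
          field_simp
          ring
        exact ⟨hval, hval.trans_le (hh.extrapolation_le hmM hx)⟩

/-! ### Thermomajorisation -/

section Hinge

variable {d : ℕ} {γ p q v w : Fin d → ℝ} {a b : ℝ}

/-- The hinge function `a ↦ ∑ᵢ (vᵢ - a γᵢ)⁺` of a vector, the Legendre dual of its
thermomajorisation curve. -/
noncomputable def hingeSum (γ v : Fin d → ℝ) (a : ℝ) : ℝ := ∑ i, max (v i - a * γ i) 0

lemma hingeSum_nonneg (γ v : Fin d → ℝ) (a : ℝ) : 0 ≤ hingeSum γ v a :=
  Finset.sum_nonneg fun _ _ => le_max_right _ _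

lemma sum_sub_le_hingeSum (γ v : Fin d → ℝ) (a : ℝ) (s : Finset (Fin d)) :
    ∑ i ∈ s, (v i - a * γ i) ≤ hingeSum γ v a :=
  (Finset.sum_le_sum fun _ _ => le_max_left _ _).trans
    (Finset.sum_le_univ_sum_of_nonneg fun _ => le_max_right _ _)

lemma hingeSum_neg_neg (γ v : Fin d → ℝ) (a : ℝ) :
    hingeSum γ (-v) (-a) = hingeSum γ v a - ∑ i, (v i - a * γ i) := by
  unfold hingeSum
  rw [← Finset.sum_sub_distrib]
  refine Finset.sum_congr rfl fun i _ => ?_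
  simp only [Pi.neg_apply]
  rcases le_total (v i - a * γ i) 0 with h | h
  · rw [max_eq_right h, max_eq_left (by linarith)]; ring
  · rw [max_eq_left h, max_eq_right (by linarith)]; ring

lemma hingeSum_of_mem_futureCone (hq : q ∈ futureCone γ v) (a : ℝ) :
    hingeSum γ q a ≤ hingeSum γ v a := by
  obtain ⟨Λ, ⟨hΛ, hγ⟩, rfl⟩ := hq
  have hq : ∀ i, max ((Λ *ᵥ v) i - a * γ i) 0 ≤ ∑ j, Λ i j * max (v j - a * γ j) 0 := by
    intro i
    refine max_le ?_ (Finset.sum_nonneg fun j _ =>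
      mul_nonneg (Matrix.nonneg_of_mem_colStochastic hΛ) (le_max_right _ _))
    have h1 : (Λ *ᵥ v) i - a * γ i = ∑ j, Λ i j * (v j - a * γ j) := by
      conv_lhs => rw [← hγ]
      simp only [Matrix.mulVec, dotProduct, Finset.mul_sum, ← Finset.sum_sub_distrib]
      exact Finset.sum_congr rfl fun j _ => by ring
    rw [h1]
    exact Finset.sum_le_sum fun j _ => mul_le_mul_of_nonneg_left (le_max_left _ _)
      (Matrix.nonneg_of_mem_colStochastic hΛ)
  refine (Finset.sum_le_sum fun i _ => hq i).trans ?_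
  rw [Finset.sum_comm]
  simp [hingeSum, ← Finset.sum_mul, Matrix.sum_col_of_mem_colStochastic hΛ]

/-- Domination of the hinge functions is the convex order of the ratios `vᵢ / γᵢ`, weighted
by `γ`. -/
lemma sum_mul_convex_le_of_hingeSum_le (hγ : ∀ i, 0 < γ i) (hsum : ∑ i, q i = ∑ i, v i)
    (hle : ∀ a, hingeSum γ q a ≤ hingeSum γ v a) {h : ℝ → ℝ} (hh : ConvexOn ℝ Set.univ h) :
    ∑ i, γ i * h (q i / γ i) ≤ ∑ i, γ i * h (v i / γ i) := by
  classical
  obtain ⟨g, hg, hgS⟩ := hh.exists_hinge_interpolant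
    (P := fun g => ∑ i, γ i * g (q i / γ i) ≤ ∑ i, γ i * g (v i / γ i))
    (fun k b => by
      have key : ∀ u : Fin d → ℝ,
          ∑ i, γ i * (k * (u i / γ i) + b) = k * ∑ i, u i + b * ∑ i, γ i := by
        intro u
        rw [Finset.mul_sum, Finset.mul_sum, ← Finset.sum_add_distrib]
        refine Finset.sum_congr rfl fun i _ => ?_
        have := (hγ i).ne'
        field_simp
      rw [key, key, hsum])
    (fun g a c hc hg => by
      have key : ∀ u : Fin d → ℝ, ∑ i, γ i * (g (u i / γ i) + c * max (u i / γ i - a) 0) =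
          ∑ i, γ i * g (u i / γ i) + c * hingeSum γ u a := by
        intro u
        rw [hingeSum, Finset.mul_sum, ← Finset.sum_add_distrib]
        refine Finset.sum_congr rfl fun i _ => ?_
        have h1 : max (u i - a * γ i) 0 = γ i * max (u i / γ i - a) 0 := by
          rw [mul_max_of_nonneg _ _ (hγ i).le, mul_zero, mul_sub,
            mul_div_cancel₀ _ (hγ i).ne', mul_comm a]
        rw [h1]
        ring
      rw [key, key]
      exact add_le_add hg (mul_le_mul_of_nonneg_left (hle a) hc))
    (Finset.univ.image (fun i => q i / γ i) ∪ Finset.univ.image (fun i => v i / γ i))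
  have e1 : ∀ i, g (q i / γ i) = h (q i / γ i) := fun i => hgS _ (by simp)
  have e2 : ∀ i, g (v i / γ i) = h (v i / γ i) := fun i => hgS _ (by simp)
  simpa only [e1, e2] using hg

/-- Thermomajorisation is sufficient: domination of the hinge functions yields a Gibbs-preserving
matrix. Otherwise a linear functional strictly separates `(γ, q)` from the compact convex set of
all `(Λ γ, Λ v)` with `Λ` column-stochastic. The maximum of the functional over that set is
attained columnwise, and the maximum of the affine functions `r ↦ bᵢ + cᵢ r` contradicts the convex
order. -/
theorem mem_futureCone_of_hingeSum_le (hγ : ∀ i, 0 < γ i) (hsum : ∑ i, q i = ∑ i, v i)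
    (hle : ∀ a, hingeSum γ q a ≤ hingeSum γ v a) : q ∈ futureCone γ v := by
  classical
  rcases isEmpty_or_nonempty (Fin d) with hd | hd
  · exact ⟨1, ⟨one_mem _, Subsingleton.elim _ _⟩, Subsingleton.elim _ _⟩
  let T : (Fin d → Fin d → ℝ) →ₗ[ℝ] (Fin d → ℝ) × (Fin d → ℝ) :=
    { toFun := fun C => (∑ j, γ j • C j, ∑ j, v j • C j)
      map_add' := fun C D => by simp [Finset.sum_add_distrib]
      map_smul' := fun r C => by
        simp only [Pi.smul_apply, Finset.smul_sum, Prod.smul_mk, RingHom.id_apply, smul_comm r] }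
  let K : Set (Fin d → Fin d → ℝ) := Set.pi Set.univ fun _ => stdSimplex ℝ (Fin d)
  have hK : IsCompact K := isCompact_univ_pi fun _ => isCompact_stdSimplex (𝕜 := ℝ) (Fin d)
  have hKc : Convex ℝ K := convex_pi fun _ _ => convex_stdSimplex ℝ (Fin d)
  by_cases hmem : (γ, q) ∈ T '' K
  · obtain ⟨C, hC, hCT⟩ := hmem
    have hC' : ∀ j, C j ∈ stdSimplex ℝ (Fin d) := fun j => hC j (Set.mem_univ j)
    have h1 : ∑ j, γ j • C j = γ := congrArg Prod.fst hCT
    have h2 : ∑ j, v j • C j = q := congrArg Prod.snd hCT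
    refine ⟨Matrix.of fun i j => C j i, ⟨Matrix.mem_colStochastic_iff_sum.2
      ⟨fun i j => (hC' j).1 i, fun j => (hC' j).2⟩, ?_⟩, ?_⟩
    · conv_rhs => rw [← h1]
      ext i
      simp [Matrix.mulVec, dotProduct, mul_comm]
    · rw [← h2]
      ext i
      simp [Matrix.mulVec, dotProduct, mul_comm]
  exfalso
  obtain ⟨f, u, hfu, huf⟩ := geometric_hahn_banach_closed_point (hKc.linear_image T)
    (hK.image T.continuous_of_finiteDimensional).isClosed hmem
  set b : Fin d → ℝ := fun i => f (Pi.single i 1, 0) with hb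
  set c : Fin d → ℝ := fun i => f (0, Pi.single i 1) with hc
  have hf : ∀ x y, f (x, y) = ∑ i, (b i * x i + c i * y i) := by
    intro x y
    have hx : (x, y) = ∑ i, (x i • ((Pi.single i 1, 0) : (Fin d → ℝ) × (Fin d → ℝ)) +
        y i • ((0, Pi.single i 1) : (Fin d → ℝ) × (Fin d → ℝ))) := by
      ext i <;> simp [Prod.fst_sum, Prod.snd_sum, Finset.sum_apply, Pi.single_apply]
    rw [hx, map_sum]
    refine Finset.sum_congr rfl fun i _ => ?_
    rw [map_add, map_smul, map_smul, smul_eq_mul, smul_eq_mul, hb, hc]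
    ring
  set h : ℝ → ℝ := fun r => Finset.univ.sup' Finset.univ_nonempty fun i => b i + c i * r
  have hle_h : ∀ i r, b i + c i * r ≤ h r := fun i r =>
    Finset.le_sup' (fun i => b i + c i * r) (Finset.mem_univ i)
  have hconv : ConvexOn ℝ Set.univ h := by
    refine ⟨convex_univ, fun x _ y _ s t hs ht hst => Finset.sup'_le _ _ fun i _ => ?_⟩
    have h1 := mul_le_mul_of_nonneg_left (hle_h i x) hs
    have h2 := mul_le_mul_of_nonneg_left (hle_h i y) ht
    simp only [smul_eq_mul]
    calc b i + c i * (s * x + t * y) = (s + t) * b i + c i * (s * x + t * y) := by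
          rw [hst, one_mul]
      _ ≤ s * h x + t * h y := by linarith
  have hmax : ∀ r, ∃ i, h r = b i + c i * r := fun r => by
    obtain ⟨i, -, hi⟩ := Finset.exists_mem_eq_sup' Finset.univ_nonempty fun i => b i + c i * r
    exact ⟨i, hi⟩
  choose m hm using hmax
  have hlow := hfu (T fun j => Pi.single (m (v j / γ j)) 1) ⟨_, fun j _ =>
    single_mem_stdSimplex ℝ _, rfl⟩
  have hval : f (T fun j => Pi.single (m (v j / γ j)) 1) = ∑ j, γ j * h (v j / γ j) := by
    have hT : (T fun j => Pi.single (m (v j / γ j)) 1) =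
        ∑ j, (γ j • (Pi.single (m (v j / γ j)) 1 : Fin d → ℝ),
          v j • (Pi.single (m (v j / γ j)) 1 : Fin d → ℝ)) := by
      ext i <;> simp [T, Prod.fst_sum, Prod.snd_sum]
    rw [hT, map_sum]
    refine Finset.sum_congr rfl fun j _ => ?_
    rw [hf, Finset.sum_eq_single (m (v j / γ j)), hm]
    · simp only [Pi.smul_apply, Pi.single_eq_same, smul_eq_mul, mul_one]
      have := (hγ j).ne'
      field_simp
    · intro i _ hi
      simp [Pi.single_eq_of_ne hi]
    · simp
  have hup : f (γ, q) ≤ ∑ i, γ i * h (q i / γ i) := by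
    rw [hf]
    refine Finset.sum_le_sum fun i _ => ?_
    have h1 := mul_le_mul_of_nonneg_left (hle_h i (q i / γ i)) (hγ i).le
    have h2 : γ i * (b i + c i * (q i / γ i)) = b i * γ i + c i * q i := by
      have := (hγ i).ne'
      field_simp
    linarith
  have := sum_mul_convex_le_of_hingeSum_le hγ hsum hle hconv
  linarith

lemma continuous_hingeSum (γ : Fin d → ℝ) (a : ℝ) : Continuous fun v => hingeSum γ v a := by
  unfold hingeSum
  fun_prop

/-- Joint convexity of the hinge function in the vector and the slope. -/
lemma hingeSum_convex_combination_le {s t : ℝ} (hs : 0 ≤ s) (ht : 0 ≤ t) :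
    hingeSum γ (s • v + t • w) (s * a + t * b) ≤ s * hingeSum γ v a + t * hingeSum γ w b := by
  unfold hingeSum
  rw [Finset.mul_sum, Finset.mul_sum, ← Finset.sum_add_distrib]
  refine Finset.sum_le_sum fun i _ => ?_
  have h1 := mul_le_mul_of_nonneg_left (le_max_left (v i - a * γ i) 0) hs
  have h2 := mul_le_mul_of_nonneg_left (le_max_left (w i - b * γ i) 0) ht
  have h3 := mul_nonneg hs (le_max_right (v i - a * γ i) 0)
  have h4 := mul_nonneg ht (le_max_right (w i - b * γ i) 0)
  refine max_le ?_ (by linarith)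
  simp only [Pi.add_apply, Pi.smul_apply, smul_eq_mul]
  linarith

end Hinge

section Extremes

variable {d : ℕ} {γ p q v : Fin d → ℝ} {a : ℝ}

lemma hingeSum_le_zero_iff : hingeSum γ v a ≤ 0 ↔ ∀ i, v i ≤ a * γ i := by
  have h0 : ∀ i ∈ Finset.univ, 0 ≤ max (v i - a * γ i) 0 := fun _ _ => le_max_right _ _
  rw [(hingeSum_nonneg γ v a).ge_iff_eq', hingeSum, Finset.sum_eq_zero_iff_of_nonneg h0]
  simp

lemma sum_sub_mul_of_sum_eq_one (hγ1 : ∑ i, γ i = 1) (hv : ∑ i, v i = 1) (a : ℝ) :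
    ∑ i, (v i - a * γ i) = 1 - a := by
  rw [Finset.sum_sub_distrib, ← Finset.mul_sum, hγ1, hv, mul_one]

lemma hingeSum_le_one_sub_iff (hγ1 : ∑ i, γ i = 1) (hv : ∑ i, v i = 1) :
    hingeSum γ v a ≤ 1 - a ↔ ∀ i, a * γ i ≤ v i := by
  have h := hingeSum_neg_neg γ v a
  rw [sum_sub_mul_of_sum_eq_one hγ1 hv] at h
  rw [← sub_nonpos, ← h, hingeSum_le_zero_iff]
  simp

/-- Let `i` and `j` carry the largest and the smallest ratio of `q`, and bound the curve of `q` by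
a line of slope `m`. Then `q` is in the future cone of the vector whose curve is this line, cut off
by steep segments at the levels `i` and `j`. -/
lemma mem_futureCone_of_hingeSum_le_of_extreme {i j : Fin d} {m φ : ℝ} (hγ : ∀ k, 0 < γ k)
    (hγ1 : ∑ k, γ k = 1) (hq : ∑ k, q k = 1) (hij : i ≠ j)
    (hi : ∀ k, q k / γ k ≤ q i / γ i) (hj : ∀ k, q j / γ j ≤ q k / γ k)
    (hφ : hingeSum γ q m ≤ φ) :
    q ∈ futureCone γ (m • γ + Pi.single i φ - Pi.single j (φ + m - 1)) := by
  classical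
  set t : Fin d → ℝ := m • γ + Pi.single i φ - Pi.single j (φ + m - 1) with ht
  have ht1 : ∑ k, t k = 1 := by
    simp [ht, Finset.sum_add_distrib, Finset.sum_sub_distrib, ← Finset.mul_sum, hγ1]
    ring
  refine mem_futureCone_of_hingeSum_le hγ (hq.trans ht1.symm) fun a => ?_
  rcases le_total m a with hma | ham
  · rcases le_total (q i / γ i) a with h | h
    · have : hingeSum γ q a ≤ 0 :=
        hingeSum_le_zero_iff.2 fun k => (div_le_iff₀ (hγ k)).1 ((hi k).trans h)
      exact this.trans (hingeSum_nonneg _ _ _)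
    · have hqi : a * γ i ≤ q i := (le_div_iff₀ (hγ i)).1 h
      have h1 : hingeSum γ q a + (a - m) * γ i ≤ hingeSum γ q m := by
        unfold hingeSum
        rw [← Finset.add_sum_erase _ _ (Finset.mem_univ i),
          ← Finset.add_sum_erase _ (fun k => max (q k - m * γ k) 0) (Finset.mem_univ i)]
        have hrest : ∑ k ∈ Finset.univ.erase i, max (q k - a * γ k) 0 ≤
            ∑ k ∈ Finset.univ.erase i, max (q k - m * γ k) 0 :=
          Finset.sum_le_sum fun k _ => max_le_max (sub_le_sub_left
            (mul_le_mul_of_nonneg_right hma (hγ k).le) _) le_rfl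
        have := le_max_left (q i - m * γ i) 0
        rw [max_eq_left (by linarith : 0 ≤ q i - a * γ i)]
        linarith
      have h2 := sum_sub_le_hingeSum γ t a {i}
      simp only [Finset.sum_singleton, ht, Pi.sub_apply, Pi.add_apply, Pi.smul_apply,
        Pi.single_eq_same, Pi.single_eq_of_ne hij, smul_eq_mul] at h2
      linarith
  · rcases le_total a (q j / γ j) with h | h
    · have h1 : hingeSum γ q a ≤ 1 - a := (hingeSum_le_one_sub_iff hγ1 hq).2 fun k =>
        (le_div_iff₀ (hγ k)).1 (h.trans (hj k))
      have h2 := sum_sub_le_hingeSum γ t a Finset.univ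
      rw [sum_sub_mul_of_sum_eq_one hγ1 ht1] at h2
      exact h1.trans h2
    · have hqj : q j ≤ a * γ j := (div_le_iff₀ (hγ j)).1 h
      have hγj : ∑ k ∈ Finset.univ.erase j, γ k = 1 - γ j := by
        rw [← hγ1, ← Finset.add_sum_erase _ _ (Finset.mem_univ j), add_sub_cancel_left]
      have h1 : hingeSum γ q a ≤ hingeSum γ q m + (m - a) * (1 - γ j) := by
        unfold hingeSum
        rw [← Finset.add_sum_erase _ _ (Finset.mem_univ j),
          ← Finset.add_sum_erase _ (fun k => max (q k - m * γ k) 0) (Finset.mem_univ j),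
          max_eq_right (by linarith), ← hγj, Finset.mul_sum, zero_add, add_assoc,
          ← Finset.sum_add_distrib]
        refine le_add_of_nonneg_of_le (le_max_right _ _) (Finset.sum_le_sum fun k _ => ?_)
        have h3 := mul_nonneg (sub_nonneg.2 ham) (hγ k).le
        have h4 := le_max_left (q k - m * γ k) 0
        have h5 := le_max_right (q k - m * γ k) 0
        exact max_le (by linarith) (by linarith)
      have h2 := sum_sub_le_hingeSum γ t a (Finset.univ.erase j)
      have h3 := sum_sub_mul_of_sum_eq_one hγ1 ht1 a
      rw [← Finset.add_sum_erase _ _ (Finset.mem_univ j)] at h3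
      simp only [ht, Pi.sub_apply, Pi.add_apply, Pi.smul_apply, Pi.single_eq_same,
        Pi.single_eq_of_ne hij.symm, smul_eq_mul] at h2 h3
      linarith

/-- Moving weight from a level `j` of small ratio to a level `i` of large ratio raises the hinge
function at every slope between the two ratios. -/
lemma hingeSum_add_le_of_transfer {i j : Fin d} {ε : ℝ} (hij : i ≠ j)
    (hi : a * γ i ≤ q i) (hj : q j ≤ a * γ j) :
    hingeSum γ q a + ε ≤ hingeSum γ (q + ε • (Pi.single i 1 - Pi.single j 1)) a := by
  classical
  have h : hingeSum γ q a + ε =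
      ∑ k, (max (q k - a * γ k) 0 + (Pi.single i ε : Fin d → ℝ) k) := by
    simp [hingeSum, Finset.sum_add_distrib]
  rw [h]
  refine Finset.sum_le_sum fun k _ => ?_
  by_cases hki : k = i
  · subst hki
    rw [max_eq_left (by linarith)]
    refine le_max_of_le_left (le_of_eq ?_)
    simp [hij]
    ring
  by_cases hkj : k = j
  · subst hkj
    rw [max_eq_right (by linarith)]
    simp [hki]
  · simp [hki, hkj]

lemma exists_perm_antitone_div (γ q : Fin d → ℝ) :
    ∃ π : Equiv.Perm (Fin d), Antitone fun i => q (π i) / γ (π i) := by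
  refine ⟨Tuple.sort fun i => -(q i / γ i), fun i j hij => ?_⟩
  have := Tuple.monotone_sort (fun i => -(q i / γ i)) hij
  exact neg_le_neg_iff.1 this

end Extremes

/-! ### Tangent vectors -/

section Tangent

variable {d : ℕ} {γ p : Fin d → ℝ} {σ : Equiv.Perm (Fin d)} {m : ℝ}

lemma IsBetaOrdering.antitone (hσ : IsBetaOrdering γ p σ) :
    Antitone (betaSlope γ p σ) := hσ

/-- Between two consecutive slopes, the hinge function of `p` is affine. -/
lemma hingeSum_eq_sum_Iic (hγ : ∀ i, 0 < γ i) {n : Fin d} (h1 : ∀ k ≤ n, m ≤ betaSlope γ p σ k)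
    (h2 : ∀ k, n < k → betaSlope γ p σ k ≤ m) :
    hingeSum γ p m = ∑ i ∈ Finset.Iic n, reorder σ p i - m * ∑ i ∈ Finset.Iic n, reorder σ γ i := by
  rw [Finset.mul_sum, ← Finset.sum_sub_distrib, hingeSum, ← Equiv.sum_comp σ.symm]
  rw [← Finset.sum_subset (Finset.subset_univ (Finset.Iic n))]
  · refine Finset.sum_congr rfl fun i hi => max_eq_left ?_
    have := (le_div_iff₀ (hγ (σ.symm i))).1 (h1 i (Finset.mem_Iic.1 hi))
    exact sub_nonneg.2 this
  · intro i _ hi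
    have := (div_le_iff₀ (hγ (σ.symm i))).1 (h2 i (not_le.1 fun h => hi (Finset.mem_Iic.2 h)))
    exact max_eq_right (sub_nonpos.2 this)

variable [NeZero d]

lemma sum_mid_eq (hd : 1 < d) (γ : Fin d → ℝ) (π : Equiv.Perm (Fin d)) :
    ∑ i with i.val ≠ 0 ∧ i.val + 1 ≠ d, γ (π i) =
      ∑ i, γ i - γ (π 0) - γ (π ⟨d - 1, by omega⟩) := by
  have hset : (Finset.univ.filter fun i : Fin d => i.val ≠ 0 ∧ i.val + 1 ≠ d) =
      (Finset.univ.erase (0 : Fin d)).erase ⟨d - 1, by omega⟩ := by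
    ext i
    simp only [Finset.mem_filter, Finset.mem_univ, true_and, Finset.mem_erase, ne_eq, and_true,
      Fin.ext_iff, Fin.val_zero]
    omega
  have hmem : (⟨d - 1, by omega⟩ : Fin d) ∈ Finset.univ.erase (0 : Fin d) := by
    simp only [Finset.mem_erase, ne_eq, Fin.ext_iff, Fin.val_zero, Finset.mem_univ, and_true]
    omega
  rw [hset, ← Equiv.sum_comp π, ← Finset.add_sum_erase _ _ (Finset.mem_univ (0 : Fin d)),
    ← Finset.add_sum_erase _ _ hmem]
  ring

/-- The curve of the tangent vector `t^(n,π)` is the line through the `n`-th piece of the curve of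
`p`, cut off at the levels `π(1)` and `π(d)`. -/
lemma tangentVector_eq (hd : 1 < d) (hγ : ∀ i, 0 < γ i) (hγ1 : ∑ i, γ i = 1)
    (hσ : IsBetaOrdering γ p σ) (n : Fin d) (π : Equiv.Perm (Fin d)) :
    tangentVector γ p σ n π = betaSlope γ p σ n • γ +
      Pi.single (π 0) (hingeSum γ p (betaSlope γ p σ n)) -
      Pi.single (π ⟨d - 1, by omega⟩)
        (hingeSum γ p (betaSlope γ p σ n) + betaSlope γ p σ n - 1) := by
  have hH := hingeSum_eq_sum_Iic (p := p) (σ := σ) hγ (n := n) (fun k hk => hσ.antitone hk)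
    (fun k hk => hσ.antitone hk.le)
  have hfirst : tangentFirst γ p σ n π =
      betaSlope γ p σ n * γ (π 0) + hingeSum γ p (betaSlope γ p σ n) := by
    rw [tangentFirst, hH]; ring
  ext j
  obtain ⟨i, rfl⟩ := π.surjective j
  simp only [tangentVector, Equiv.symm_apply_apply, tangentOrdered, Pi.sub_apply, Pi.add_apply,
    Pi.smul_apply, smul_eq_mul, Pi.single_apply, π.injective.eq_iff, Fin.ext_iff, Fin.val_zero]
  by_cases h0 : i.val = 0
  · have hi : i = 0 := Fin.ext h0
    rw [if_pos h0, if_pos h0, if_neg (by omega), hfirst, hi, sub_zero]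
  by_cases h1 : i.val + 1 = d
  · have hi : i = ⟨d - 1, by omega⟩ := Fin.ext (by simp only; omega)
    rw [if_neg h0, if_pos h1, if_neg h0, if_pos (by omega), tangentLast, hfirst, sum_mid_eq hd, hγ1,
      hi]
    ring
  · rw [if_neg h0, if_neg h1, if_neg h0, if_neg (by omega), add_zero, sub_zero]

/-- At its own slope, the curve of a tangent vector is no higher than that of `p`. -/
lemma hingeSum_tangentVector_le (hd : 1 < d) (hγ : ∀ i, 0 < γ i) (hγ1 : ∑ i, γ i = 1)
    (hp : ∑ i, p i = 1) (hσ : IsBetaOrdering γ p σ) (n : Fin d) (π : Equiv.Perm (Fin d)) :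
    hingeSum γ (tangentVector γ p σ n π) (betaSlope γ p σ n) ≤
      hingeSum γ p (betaSlope γ p σ n) := by
  set s := betaSlope γ p σ n with hs
  set φ := hingeSum γ p s with hφ
  have hφ0 : 0 ≤ φ := hingeSum_nonneg _ _ _
  have hψ : 0 ≤ φ + s - 1 := by
    have := sum_sub_le_hingeSum γ p s Finset.univ
    rw [sum_sub_mul_of_sum_eq_one hγ1 hp] at this
    linarith
  rw [tangentVector_eq hd hγ hγ1 hσ]
  calc _ ≤ ∑ k, (Pi.single (π 0) φ : Fin d → ℝ) k := by
        refine Finset.sum_le_sum fun k _ => ?_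
        have e1 : 0 ≤ (Pi.single (π 0) φ : Fin d → ℝ) k := by
          rw [Pi.single_apply]; split_ifs <;> simp [hφ0]
        have e2 : 0 ≤ (Pi.single (π ⟨d - 1, by omega⟩) (φ + s - 1) : Fin d → ℝ) k := by
          rw [Pi.single_apply]; split_ifs <;> simp [hψ]
        refine max_le ?_ e1
        simp only [Pi.sub_apply, Pi.add_apply, Pi.smul_apply, smul_eq_mul, ← hs, ← hφ]
        linarith
    _ = φ := by simp

/-- A slope strictly below the first and not below the last one lies between two consecutive
slopes. -/
lemma exists_betaSlope_le_le (h0 : m < betaSlope γ p σ 0)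
    (hlast : betaSlope γ p σ ⟨d - 1, Nat.sub_lt (NeZero.pos d) one_pos⟩ ≤ m) :
    ∃ (i : ℕ) (hi : i + 1 < d), betaSlope γ p σ ⟨i + 1, hi⟩ ≤ m ∧
      m ≤ betaSlope γ p σ ⟨i, Nat.lt_of_succ_lt hi⟩ := by
  by_contra! H
  have key : ∀ (i : ℕ) (hi : i < d), m < betaSlope γ p σ ⟨i, hi⟩ := by
    intro i
    induction i with
    | zero => exact fun _ => h0
    | succ i ih =>
      intro hi
      by_contra! hle
      exact (H i hi hle).not_gt (ih _)
  exact (key (d - 1) (Nat.sub_lt (NeZero.pos d) one_pos)).not_ge hlast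

lemma betaSlope_le_zero (hσ : IsBetaOrdering γ p σ) (n : Fin d) :
    betaSlope γ p σ n ≤ betaSlope γ p σ 0 := hσ.antitone (Fin.zero_le n)

lemma last_le_betaSlope (hσ : IsBetaOrdering γ p σ) (n : Fin d) :
    betaSlope γ p σ ⟨d - 1, Nat.sub_lt (NeZero.pos d) one_pos⟩ ≤ betaSlope γ p σ n :=
  hσ.antitone (Fin.le_def.2 (by have := n.isLt; simp only; omega))

/-- If the curve of `q` stays below some tangent line of the curve of `p`, then `q` is in the
tangent region: the tangent line is a convex combination of two consecutive pieces, and `π` is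
an ordering of `q`. -/
theorem mem_tangentRegion_of_hingeSum_lt {q : Fin d → ℝ} (hγ : ∀ i, 0 < γ i)
    (hγ1 : ∑ i, γ i = 1) (hp : ∑ i, p i = 1) (hq : ∑ i, q i = 1) (hσ : IsBetaOrdering γ p σ)
    (hlt : hingeSum γ q m < hingeSum γ p m) : q ∈ tangentRegion γ p σ := by
  have h0 : m < betaSlope γ p σ 0 := by
    by_contra! h
    have : hingeSum γ p m ≤ 0 := hingeSum_le_zero_iff.2 fun i => by
      have := (betaSlope_le_zero hσ (σ i)).trans h
      simpa [reorder] using (div_le_iff₀ (hγ _)).1 this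
    exact (hlt.trans_le this).not_ge (hingeSum_nonneg _ _ _)
  have hlast : betaSlope γ p σ ⟨d - 1, Nat.sub_lt (NeZero.pos d) one_pos⟩ ≤ m := by
    by_contra! h
    have h1 : hingeSum γ p m ≤ 1 - m := (hingeSum_le_one_sub_iff hγ1 hp).2 fun i => by
      have := h.le.trans (last_le_betaSlope hσ (σ i))
      simpa [reorder] using (le_div_iff₀ (hγ _)).1 this
    have h2 := sum_sub_le_hingeSum γ q m Finset.univ
    rw [sum_sub_mul_of_sum_eq_one hγ1 hq] at h2
    linarith
  obtain ⟨i, hi, hlo, hhi⟩ := exists_betaSlope_le_le h0 hlast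
  have hd : 1 < d := by omega
  set a : Fin d := ⟨i, Nat.lt_of_succ_lt hi⟩
  set b : Fin d := ⟨i + 1, hi⟩
  obtain ⟨π, hπ⟩ := exists_perm_antitone_div γ q
  obtain ⟨s, t, hs, ht, hst, hm⟩ : m ∈ segment ℝ (betaSlope γ p σ a) (betaSlope γ p σ b) := by
    rw [segment_symm, segment_eq_Icc (hlo.trans hhi)]
    exact ⟨hlo, hhi⟩
  simp only [smul_eq_mul] at hm
  have hab : ∀ k, a < k → b ≤ k := fun k hk => Fin.le_def.2 (Fin.lt_def.1 hk)
  have hlin : hingeSum γ p m = s * hingeSum γ p (betaSlope γ p σ a) +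
      t * hingeSum γ p (betaSlope γ p σ b) := by
    rw [hingeSum_eq_sum_Iic (σ := σ) hγ (fun k hk => hhi.trans (hσ.antitone hk))
        (fun k hk => (hσ.antitone (hab k hk)).trans hlo),
      hingeSum_eq_sum_Iic (σ := σ) hγ (n := a) (fun k hk => hσ.antitone hk)
        (fun k hk => hσ.antitone hk.le),
      hingeSum_eq_sum_Iic (σ := σ) hγ (n := a) (fun k hk => (hlo.trans hhi).trans (hσ.antitone hk))
        (fun k hk => hσ.antitone (hab k hk)), ← hm]
    linear_combination (-∑ i ∈ Finset.Iic a, reorder σ p i) * hst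
  have hij : π 0 ≠ π ⟨d - 1, by omega⟩ := fun h => by
    have := congrArg Fin.val (π.injective h)
    simp only [Fin.val_zero] at this
    omega
  have hmem := mem_futureCone_of_hingeSum_le_of_extreme hγ hγ1 hq hij
    (fun k => by simpa using hπ (Fin.zero_le (π.symm k)))
    (fun k => by
      have hk : π.symm k ≤ ⟨d - 1, by omega⟩ :=
        Fin.le_def.2 (by have := (π.symm k).isLt; simp only; omega)
      simpa using hπ hk) hlt.le
  have hcomb : m • γ + Pi.single (π 0) (hingeSum γ p m) -
      Pi.single (π ⟨d - 1, by omega⟩) (hingeSum γ p m + m - 1) =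
      s • tangentVector γ p σ a π + t • tangentVector γ p σ b π := by
    rw [tangentVector_eq hd hγ hγ1 hσ, tangentVector_eq hd hγ hγ1 hσ, hlin, ← hm]
    ext k
    simp only [Pi.sub_apply, Pi.add_apply, Pi.smul_apply, smul_eq_mul, Pi.single_apply]
    split_ifs
    · linear_combination -hst
    · ring
    · linear_combination -hst
    · ring
  rw [hcomb] at hmem
  obtain ⟨Λ, hΛ, rfl⟩ := hmem
  refine Set.mem_iUnion.2 ⟨π, Set.mem_iUnion₂.2 ⟨i, hi, ?_⟩⟩
  rw [Matrix.mulVec_add, Matrix.mulVec_smul, Matrix.mulVec_smul]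
  have ha' : Λ *ᵥ tangentVector γ p σ a π ∈ futureCone γ (tangentVector γ p σ a π) :=
    ⟨Λ, hΛ, rfl⟩
  have hb' : Λ *ᵥ tangentVector γ p σ b π ∈ futureCone γ (tangentVector γ p σ b π) :=
    ⟨Λ, hΛ, rfl⟩
  exact convex_convexHull ℝ _ (subset_convexHull ℝ _ (Set.mem_union_left _ ha'))
    (subset_convexHull ℝ _ (Set.mem_union_right _ hb')) hs ht hst

/-- Conversely, at some slope of the curve of `p`, a vector of the tangent region has a curve no
higher than that of `p`. -/
theorem exists_hingeSum_le_of_mem_tangentRegion {x : Fin d → ℝ} (hγ : ∀ i, 0 < γ i)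
    (hγ1 : ∑ i, γ i = 1) (hp : ∑ i, p i = 1) (hσ : IsBetaOrdering γ p σ)
    (hx : x ∈ tangentRegion γ p σ) :
    ∃ m, betaSlope γ p σ ⟨d - 1, Nat.sub_lt (NeZero.pos d) one_pos⟩ ≤ m ∧
      m ≤ betaSlope γ p σ 0 ∧ hingeSum γ x m ≤ hingeSum γ p m := by
  obtain ⟨π, hx⟩ := Set.mem_iUnion.1 hx
  obtain ⟨i, hi, hx⟩ := Set.mem_iUnion₂.1 hx
  have hd : 1 < d := by omega
  set a : Fin d := ⟨i, Nat.lt_of_succ_lt hi⟩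
  set b : Fin d := ⟨i + 1, hi⟩
  have hba : betaSlope γ p σ b ≤ betaSlope γ p σ a := hσ.antitone (Fin.le_def.2 (Nat.le_succ i))
  have hab : ∀ k, a < k → b ≤ k := fun k hk => Fin.le_def.2 (Fin.lt_def.1 hk)
  -- On `[betaSlope b, betaSlope a]` the hinge function of `p` is affine, so `D` is convex.
  let D : Set (Fin d → ℝ) := {y | ∃ m, betaSlope γ p σ b ≤ m ∧ m ≤ betaSlope γ p σ a ∧
    hingeSum γ y m ≤ hingeSum γ p m}
  have hlin : ∀ m, betaSlope γ p σ b ≤ m → m ≤ betaSlope γ p σ a → hingeSum γ p m =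
      ∑ i ∈ Finset.Iic a, reorder σ p i - m * ∑ i ∈ Finset.Iic a, reorder σ γ i :=
    fun m hlo hhi => hingeSum_eq_sum_Iic hγ (fun k hk => hhi.trans (hσ.antitone hk))
      (fun k hk => (hσ.antitone (hab k hk)).trans hlo)
  have hD : Convex ℝ D := by
    rintro y ⟨m, hm1, hm2, hy⟩ z ⟨n, hn1, hn2, hz⟩ s t hs ht hst
    have hmn := convex_Icc (𝕜 := ℝ) (betaSlope γ p σ b) (betaSlope γ p σ a)
      ⟨hm1, hm2⟩ ⟨hn1, hn2⟩ hs ht hst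
    simp only [smul_eq_mul] at hmn
    refine ⟨s * m + t * n, hmn.1, hmn.2, (hingeSum_convex_combination_le hs ht).trans ?_⟩
    have h1 := mul_le_mul_of_nonneg_left hy hs
    have h2 := mul_le_mul_of_nonneg_left hz ht
    rw [hlin m hm1 hm2] at h1
    rw [hlin n hn1 hn2] at h2
    rw [hlin _ hmn.1 hmn.2]
    calc _ ≤ _ := add_le_add h1 h2
      _ = _ := by linear_combination (∑ i ∈ Finset.Iic a, reorder σ p i) * hst
  have hsub : futureCone γ (tangentVector γ p σ a π) ∪
      futureCone γ (tangentVector γ p σ b π) ⊆ D := by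
    rintro y (hy | hy)
    · exact ⟨_, hba, le_rfl, (hingeSum_of_mem_futureCone hy _).trans
        (hingeSum_tangentVector_le hd hγ hγ1 hp hσ a π)⟩
    · exact ⟨_, le_rfl, hba, (hingeSum_of_mem_futureCone hy _).trans
        (hingeSum_tangentVector_le hd hγ hγ1 hp hσ b π)⟩
  obtain ⟨m, hm1, hm2, hm⟩ := convexHull_min hsub hD hx
  exact ⟨m, (last_le_betaSlope hσ b).trans hm1, hm2.trans (betaSlope_le_zero hσ a), hm⟩

/-! ### The interior of the tangent region -/

/-- The complement of the past thermal cone is, within the normalised vectors, the interior of the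
tangent region. Strict inequality of hinge functions is an open condition; and if `q`
thermomajorises `p`, then transferring an arbitrarily small weight between the extreme levels
of `q` leaves the tangent region. -/
theorem mem_hyperplaneInterior_tangentRegion_iff {q : Fin d → ℝ} (hγ : ∀ i, 0 < γ i)
    (hγ1 : ∑ i, γ i = 1) (hp : ∑ i, p i = 1) (hq : ∑ i, q i = 1) (hσ : IsBetaOrdering γ p σ) :
    q ∈ hyperplaneInterior (tangentRegion γ p σ) ↔ p ∉ futureCone γ q := by
  constructor
  · rintro ⟨x, hx, rfl⟩ hfut
    have hle := hingeSum_of_mem_futureCone hfut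
    have hreg : x ∈ ((↑) : quasiProb d → (Fin d → ℝ)) ⁻¹' tangentRegion γ p σ := interior_subset hx
    have hd : 1 < d := by
      obtain ⟨π, h⟩ := Set.mem_iUnion.1 hreg
      obtain ⟨i, hi, -⟩ := Set.mem_iUnion₂.1 h
      omega
    obtain ⟨π, hπ⟩ := exists_perm_antitone_div γ (x : Fin d → ℝ)
    set i := π 0
    set j := π ⟨d - 1, by omega⟩
    have hij : i ≠ j := fun h => by
      have := congrArg Fin.val (π.injective h)
      simp only [Fin.val_zero] at this
      omega
    have hi : ∀ k, (x : Fin d → ℝ) k / γ k ≤ (x : Fin d → ℝ) i / γ i := fun k => by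
      simpa using hπ (Fin.zero_le (π.symm k))
    have hj : ∀ k, (x : Fin d → ℝ) j / γ j ≤ (x : Fin d → ℝ) k / γ k := fun k => by
      have hk : π.symm k ≤ ⟨d - 1, by omega⟩ :=
        Fin.le_def.2 (by have := (π.symm k).isLt; simp only; omega)
      simpa using hπ hk
    -- The slopes of `p` lie between the extreme ratios of the thermomajorising vector.
    have hpi : ∀ k, p k ≤ (x : Fin d → ℝ) i / γ i * γ k := hingeSum_le_zero_iff.1
      ((hle _).trans (hingeSum_le_zero_iff.2 fun k => (div_le_iff₀ (hγ k)).1 (hi k)))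
    have hpj : ∀ k, (x : Fin d → ℝ) j / γ j * γ k ≤ p k := (hingeSum_le_one_sub_iff hγ1 hp).1
      ((hle _).trans ((hingeSum_le_one_sub_iff hγ1 hq).2
        fun k => (le_div_iff₀ (hγ k)).1 (hj k)))
    set y : ℝ → Fin d → ℝ := fun ε =>
      (x : Fin d → ℝ) + ε • ((Pi.single i 1 - Pi.single j 1 : Fin d → ℝ)) with hy
    have hy1 : ∀ ε, ∑ k, y ε k = 1 := fun ε => by
      simp [hy, Finset.sum_add_distrib, Finset.sum_sub_distrib, ← Finset.mul_sum, hq]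
    let path : ℝ → quasiProb d := fun ε => ⟨y ε, hy1 ε⟩
    have hpath : Continuous path := Continuous.subtype_mk (by fun_prop) _
    have hpath0 : path 0 = x := Subtype.ext (by simp [path, hy])
    have hopen : IsOpen (path ⁻¹' interior (((↑) : quasiProb d → (Fin d → ℝ)) ⁻¹'
        tangentRegion γ p σ)) := isOpen_interior.preimage hpath
    obtain ⟨ε, hε, hball⟩ := Metric.isOpen_iff.1 hopen 0 (by rwa [Set.mem_preimage, hpath0])
    have hmem : path (ε / 2) ∈ interior (((↑) : quasiProb d → (Fin d → ℝ)) ⁻¹'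
        tangentRegion γ p σ) := hball (by
      rw [Metric.mem_ball, dist_zero_right, Real.norm_of_nonneg (by positivity)]; linarith)
    have hreg' := interior_subset hmem
    obtain ⟨m, hlo, hhi, hm⟩ := exists_hingeSum_le_of_mem_tangentRegion hγ hγ1 hp hσ
      (x := y (ε / 2)) (Set.mem_preimage.1 hreg')
    have hmi : m ≤ (x : Fin d → ℝ) i / γ i :=
      hhi.trans ((div_le_iff₀ (hγ _)).2 (hpi _))
    have hmj : (x : Fin d → ℝ) j / γ j ≤ m :=
      ((le_div_iff₀ (hγ _)).2 (hpj _)).trans hlo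
    have htrans := hingeSum_add_le_of_transfer (γ := γ) (ε := ε / 2) hij
      ((le_div_iff₀ (hγ i)).1 hmi) ((div_le_iff₀ (hγ j)).1 hmj)
    have : hingeSum γ p m + ε / 2 ≤ hingeSum γ (y (ε / 2)) m :=
      (add_le_add_left (hle m) _).trans htrans
    linarith
  · intro hfut
    obtain ⟨m, hm⟩ : ∃ m, hingeSum γ q m < hingeSum γ p m := by
      by_contra! H
      exact hfut (mem_futureCone_of_hingeSum_le hγ (hp.trans hq.symm) H)
    refine ⟨⟨q, hq⟩, mem_interior.2 ⟨{x | hingeSum γ x m < hingeSum γ p m}, fun x hx =>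
      mem_tangentRegion_of_hingeSum_lt hγ hγ1 hp x.2 hσ hx, ?_, hm⟩, rfl⟩
    exact isOpen_lt ((continuous_hingeSum γ m).comp continuous_subtype_val) continuous_const

end Tangent

/-! ### The Gibbs distribution -/

lemma gibbs_pos {d : ℕ} (β : ℝ) (E : Fin d → ℝ) (i : Fin d) : 0 < gibbs β E i :=
  div_pos (Real.exp_pos _) (Finset.sum_pos (fun _ _ => Real.exp_pos _) ⟨i, Finset.mem_univ i⟩)

lemma sum_gibbs {d : ℕ} [NeZero d] (β : ℝ) (E : Fin d → ℝ) : ∑ i, gibbs β E i = 1 := by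
  unfold gibbs
  rw [← Finset.sum_div]
  exact div_self (Finset.sum_pos (fun _ _ => Real.exp_pos _) Finset.univ_nonempty).ne'

theorem mainTheorem5 (d : ℕ) [NeZero d] (β : ℝ) (hβ : 0 < β) (E : Fin d → ℝ)
    (p : Fin d → ℝ) (hp : p ∈ stdSimplex ℝ (Fin d))
    (σ : Equiv.Perm (Fin d)) (hσ : IsBetaOrdering (gibbs β E) p σ) :
    incomparableRegion (gibbs β E) p =
        (hyperplaneInterior (tangentRegion (gibbs β E) p σ) \ futureCone (gibbs β E) p) ∩
          stdSimplex ℝ (Fin d) ∧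
      pastCone (gibbs β E) p =
        stdSimplex ℝ (Fin d) \ hyperplaneInterior (tangentRegion (gibbs β E) p σ) := by
  have key : ∀ q ∈ stdSimplex ℝ (Fin d),
      (q ∈ hyperplaneInterior (tangentRegion (gibbs β E) p σ) ↔ q ∉ pastCone (gibbs β E) p) := by
    intro q hq
    rw [mem_hyperplaneInterior_tangentRegion_iff (gibbs_pos β E) (sum_gibbs β E) hp.2 hq.2 hσ]
    exact not_congr ⟨fun h => ⟨hq, h⟩, fun h => h.2⟩
  constructor
  · ext q
    constructor
    · rintro ⟨hq, hpast, hfut⟩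
      exact ⟨⟨(key q hq).2 hpast, hfut⟩, hq⟩
    · rintro ⟨⟨hint, hfut⟩, hq⟩
      exact ⟨hq, (key q hq).1 hint, hfut⟩
  · ext q
    constructor
    · exact fun hq => ⟨hq.1, fun h => (key q hq.1).1 h hq⟩
    · rintro ⟨hq, hint⟩
      by_contra h
      exact hint ((key q hq).2 h)
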